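/- A big tt-category is a rigidly-compactly generated tensor-triangulated category: a triangulated category $\mathsf{T}$ with small coproducts and a symmetric monoidal structure $(\otimes,\mathbf 1)$ that is exact and preserves small coproducts in each variable, whose compact objects coincide with its rigid (dualizable) objects, form an essentially small subcategory, and generate $\mathsf{T}$ as a localizing subcategory. A localizing tensor ideal is a (strictly full) triangulated subcategory closed under small coproducts and under tensoring with arbitrary objects of $\mathsf{T}$; $\mathrm{Loc}^\otimes(\mathcal A)$ denotes the smallest one containing $\mathcal A$. A localizing tensor ideal $\mathsf{S}$ is smashing if its localization functor is given by tensoring with an object, i.e. if there is an exact triangle $E\to\mathbf 1\to R\to\Sigma E$ with $E\in\mathsf{S}$ and $\mathrm{Hom}(\mathsf{S},R\otimes X)=0$ for all $X\in\mathsf{T}$. Let $\mathcal S(\mathsf{T})$ be the collection of smashing ideals of $\mathsf{T}$, ordered by inclusion, and, once it is known to be a frame, let $\mathrm{Spc}^s(\mathsf{T})$ be its Stone dual: the space of frame morphisms $p\colon\mathcal S(\mathsf{T})\to\{0,1\}$, with open sets $\{p\mid p(\mathsf{S})=1\}$ for $\mathsf{S}\in\mathcal S(\mathsf{T})$. **Proposition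 (functoriality of the smashing spectrum).** Let $F\colon\mathsf{T}\to\mathsf{U}$ be an exact, small-coproduct-preserving, (strong) monoidal functor between big tt-categories. Then $\mathcal S(\mathsf{T})$ and $\mathcal S(\mathsf{U})$ are frames; for every $\mathsf{S}\in\mathcal S(\mathsf{T})$ the ideal $\mathrm{Loc}^\otimes(F\mathsf{S})$ is smashing in $\mathsf{U}$; and $f\colon\mathcal S(\mathsf{T})\to\mathcal S(\mathsf{U})$, $f(\mathsf{S})=\mathrm{Loc}^\otimes(F\mathsf{S})$, is a morphism of frames (it preserves finite meets and arbitrary joins). Hence $p\mapsto p\circ f$ is a continuous map $\mathrm{Spc}^s(\mathsf{U})\to\mathrm{Spc}^s(\mathsf{T})$. -/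

import Mathlib

open CategoryTheory Limits MonoidalCategory

universe v u u'

/-- A partially ordered set is a frame: every subset has a supremum, and binary infima distribute
over arbitrary suprema. (The order determines all of the frame structure.) -/
structure IsFrame (α : Type u) [PartialOrder α] : Prop where
  exists_isLUB : ∀ s : Set α, ∃ a, IsLUB s a
  isLUB_inf : ∀ (a : α) (s : Set α) (b m : α), IsLUB s b → IsGLB {a, b} m →
    IsLUB {d | ∃ x ∈ s, IsGLB {a, x} d} m

/-- The `Order.Frame` whose order is the given one. -/
@[reducible]
noncomputable def IsFrame.toFrame {α : Type u} [PartialOrder α] (h : IsFrame α) :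
    Order.Frame α :=
  letI : SupSet α := ⟨fun s => (h.exists_isLUB s).choose⟩
  letI : CompleteLattice α := completeLatticeOfSup α fun s => (h.exists_isLUB s).choose_spec
  Order.Frame.ofMinimalAxioms
    { inf_sSup_le_iSup_inf := fun a s => by
        refine (h.isLUB_inf a s (sSup s) _ (isLUB_sSup s) isGLB_pair).2 ?_
        rintro d ⟨x, hx, hd⟩
        exact (isGLB_pair.unique hd).symm.le.trans (le_iSup₂ (f := fun b _ => a ⊓ b) x hx) }

section Localizing

variable {T : Type u} [Category.{v} T] [Preadditive T] [HasZeroObject T] [HasShift T ℤ]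
  [∀ n : ℤ, (shiftFunctor T n).Additive] [Pretriangulated T]

/-- An object `c` is compact if `Hom(c, -)` preserves small coproducts. -/
def isCompactObject (T : Type u) [Category.{v} T] [Preadditive T] : ObjectProperty T :=
  fun c => ∀ ι : Type v,
    PreservesColimitsOfShape (Discrete ι) (preadditiveCoyoneda.obj (Opposite.op c))

/-- A localizing subcategory: a strictly full triangulated subcategory closed under small
coproducts. -/
structure IsLocalizing (S : ObjectProperty T) : Prop where
  isTriangulated : S.IsTriangulated
  isClosedUnderIsomorphisms : S.IsClosedUnderIsomorphisms
  closed_coproducts : ∀ ι : Type v, S.IsClosedUnderColimitsOfShape (Discrete ι)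

variable [MonoidalCategory T]

/-- A localizing tensor ideal. -/
structure IsLocalizingIdeal (S : ObjectProperty T) : Prop extends IsLocalizing S where
  tensor_mem : ∀ X Y : T, S Y → S (X ⊗ Y)

/-- `Loc^⊗(A)`, the smallest localizing tensor ideal containing `A`. -/
def locIdeal (A : ObjectProperty T) : ObjectProperty T :=
  fun X => ∀ S : ObjectProperty T, IsLocalizingIdeal S → A ≤ S → S X

/-- A smashing ideal: a localizing tensor ideal `S` whose localization functor exists and is
given by tensoring with an object. That is, there is a distinguished triangle `E ⟶ 𝟙 ⟶ F ⟶ E⟦1⟧`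
with `E` in `S` and such that each `F ⊗ X` is `S`-local (it receives no nonzero map from `S`);
the localization triangle of `X` is then `E ⊗ X ⟶ X ⟶ F ⊗ X ⟶ (E ⊗ X)⟦1⟧`. -/
structure IsSmashingIdeal (S : ObjectProperty T) : Prop extends IsLocalizingIdeal S where
  exists_triangle : ∃ (E F : T) (e : E ⟶ 𝟙_ T) (f : 𝟙_ T ⟶ F) (d : F ⟶ E⟦(1 : ℤ)⟧),
    Pretriangulated.Triangle.mk e f d ∈ Pretriangulated.distinguishedTriangles ∧
      S E ∧ ∀ X : T, S.rightOrthogonal (F ⊗ X)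

end Localizing

/-- The collection `𝒮(T)` of smashing ideals of `T`, ordered by inclusion. -/
abbrev SmashingIdeal (T : Type u) [Category.{v} T] [Preadditive T] [HasZeroObject T]
    [HasShift T ℤ] [∀ n : ℤ, (shiftFunctor T n).Additive] [Pretriangulated T]
    [MonoidalCategory T] : Type u :=
  {S : ObjectProperty T // IsSmashingIdeal S}

/-- A big tt-category, i.e. a rigidly-compactly generated tensor-triangulated category: a
triangulated category with small coproducts and a symmetric monoidal structure whose tensor
product is exact and preserves small coproducts in each variable, in which the compact objects
coincide with the rigid ones, are essentially small, and generate `T` as a localizing subcategory.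
(By symmetry it suffices to mention the functors `X ⊗ -`, and a dual on one side.) -/
class BigTTCategory (T : Type u) [Category.{v} T] [Preadditive T] [HasZeroObject T]
    [HasShift T ℤ] [∀ n : ℤ, (shiftFunctor T n).Additive] [Pretriangulated T]
    [IsTriangulated T] [MonoidalCategory T] [SymmetricCategory T] : Prop where
  hasCoproducts : HasCoproducts.{v} T
  tensor_exact : ∀ X : T, ∃ _ : (tensorLeft X).CommShift ℤ, (tensorLeft X).IsTriangulated
  tensor_coproducts : ∀ (X : T) (ι : Type v),
    PreservesColimitsOfShape (Discrete ι) (tensorLeft X)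
  compact_iff_rigid : ∀ X : T, isCompactObject T X ↔ ∃ Y : T, Nonempty (ExactPairing X Y)
  essentiallySmall_compact : ObjectProperty.EssentiallySmall.{v} (isCompactObject T)
  generated : ∀ S : ObjectProperty T, IsLocalizing S → isCompactObject T ≤ S → ∀ X : T, S X

/-!
The proof identifies smashing ideals with idempotent triangles: distinguished triangles
`E ⟶ 𝟙 ⟶ R ⟶ E⟦1⟧` with `R ⊗ E = 0`. The ideal attached to such a triangle consists of the
`R`-acyclic objects, i.e. those `X` with `R ⊗ X = 0`, equivalently those for which `E ⊗ X ⟶ X` is an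
isomorphism (`IsSmashingIdeal.exists_eq_acyclics`, `IdempotentTriangle.isSmashingIdeal`). An exact
monoidal functor `F` sends idempotent triangles to idempotent triangles, and the `F R`-acyclic
objects are `Loc^⊗` of the image of the `R`-acyclic ones
(`IdempotentTriangle.locIdeal_map_acyclics`). The intersection of two smashing ideals is smashing,
with left idempotent `E ⊗ E'`; this gives binary meets and their preservation.

For a small family of idempotent triangles let `C` be the cone of `∐ E i ⟶ 𝟙`. The right idempotent
of the join is the homotopy colimit `R` of the sequence `𝟙 ⟶ C ⟶ C ⊗ C ⟶ ⋯`. Tensoring with `E i`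
kills the transition morphisms, because `E i ⊗ E i ≅ E i` and `E i ⟶ 𝟙 ⟶ C` is zero; hence
`E i ⊗ R = 0` (`IdempotentTriangle.isZero_tensor_joinR`). On the other hand an exact
coproduct-preserving functor which kills every `E i ⊗ X` inverts the transition morphisms, hence
also `𝟙 ⟶ R` (`IdempotentTriangle.isIso_map_joinUnit`). Applied to the functors `X ↦ F X ⊗ W`, this
shows that the ideal of `R` is the least upper bound, that binary meets distribute over joins, and
that joins are preserved by `F`.

Coproducts are only available for families indexed by the universe of the morphisms, so arbitrary
joins require the smashing ideals to form a small set (`small_smashingIdeal`). This is where compact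
generation enters. For compact `c` the group `Hom(c, R ⊗ X)` is the filtered colimit of the
`Hom(c, R ⊗ d)` over compact objects `d ⟶ X` (`isCompactlyApproximated`): the objects `X` all of
whose shifts have this property form a localizing subcategory which contains the compact ones. Hence
a morphism from a compact `c` to an object `X` of a smashing ideal `S` factors through some `c ⟶ e`
with `e` compact which itself factors through `S`. It follows that `S` is determined by the
morphisms of compact objects which factor through `S`.
-/

/-! ### Finite subcoproducts and compactness -/

section Additive

variable {C : Type u} [Category.{v} C]

lemma isClosedUnderColimitsOfShape_discrete {P : ObjectProperty C} [P.IsClosedUnderIsomorphisms]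
    {ι : Type*} [HasColimitsOfShape (Discrete ι) C]
    (h : ∀ Y : ι → C, (∀ i, P (Y i)) → P (∐ Y)) :
    P.IsClosedUnderColimitsOfShape (Discrete ι) := by
  refine .mk' ?_
  rintro _ ⟨K, hK⟩
  let Y : ι → C := fun i => K.obj ⟨i⟩
  exact P.prop_of_iso (HasColimit.isoOfNatIso (Discrete.natIsoFunctor (F := K)).symm)
    (h Y fun i => hK ⟨i⟩)

variable [Preadditive C]

open scoped Classical in
/-- The idempotent endomorphism of `∐ X` which projects onto the finite subcoproduct of the `X i`
with `i ∈ s`. -/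
noncomputable def sigmaTrunc {ι : Type*} (X : ι → C) [HasCoproduct X] (s : Finset ι) :
    ∐ X ⟶ ∐ X :=
  ∑ i ∈ s, Sigma.π X i ≫ Sigma.ι X i

section

variable {ι : Type*} (X : ι → C) [HasCoproduct X]

lemma ι_sigmaTrunc {s : Finset ι} {i : ι} (hi : i ∈ s) :
    Sigma.ι X i ≫ sigmaTrunc X s = Sigma.ι X i := by
  classical
  rw [sigmaTrunc, Preadditive.comp_sum, Finset.sum_eq_single i]
  · simp
  · intro j _ hj
    rw [Sigma.ι_π_of_ne_assoc _ hj.symm, zero_comp]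
  · exact fun h => (h hi).elim

lemma sigmaTrunc_comp_of_le {s t : Finset ι} (h : s ≤ t) :
    sigmaTrunc X s ≫ sigmaTrunc X t = sigmaTrunc X s := by
  conv_lhs => arg 1; rw [sigmaTrunc]
  conv_rhs => rw [sigmaTrunc]
  rw [Preadditive.sum_comp]
  exact Finset.sum_congr rfl fun i hi => by rw [Category.assoc, ι_sigmaTrunc X (h hi)]

/-- The universal property of the coproduct forces its value under a coproduct-preserving functor
to be generated, as an abelian group, by the images of the summands. -/
lemma exists_map_sigmaTrunc_apply_eq (H : C ⥤ AddCommGrpCat.{v}) [H.Additive]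
    [PreservesColimit (Discrete.functor X) H] (x : H.obj (∐ X)) :
    ∃ s : Finset ι, ∀ t, s ≤ t → H.map (sigmaTrunc X t) x = x := by
  classical
  let N : AddSubgroup (H.obj (∐ X)) := ⨆ i, (H.map (Sigma.ι X i)).hom.range
  let q : H.obj (∐ X) ⟶ AddCommGrpCat.of (H.obj (∐ X) ⧸ N) :=
    AddCommGrpCat.ofHom (QuotientAddGroup.mk' N)
  have hq : q = 0 := by
    refine (isColimitOfHasCoproductOfPreservesColimit H X).hom_ext ?_
    rintro ⟨i⟩
    ext y
    change QuotientAddGroup.mk' N (H.map (Sigma.ι X i) y) = 0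
    rw [QuotientAddGroup.mk'_apply, QuotientAddGroup.eq_zero_iff]
    exact AddSubgroup.mem_iSup_of_mem i ⟨y, rfl⟩
  have hN : x ∈ N := by
    rw [← QuotientAddGroup.eq_zero_iff]
    exact congr($hq x)
  induction hN using AddSubgroup.iSup_induction' with
  | hp i x hx =>
    obtain ⟨y, rfl⟩ := hx
    refine ⟨{i}, fun t ht => ?_⟩
    have := ι_sigmaTrunc X (ht (Finset.mem_singleton_self i))
    change H.map (sigmaTrunc X t) (H.map (Sigma.ι X i) y) = H.map (Sigma.ι X i) y
    rw [← ConcreteCategory.comp_apply, ← H.map_comp, this]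
  | h1 => exact ⟨∅, fun t _ => map_zero _⟩
  | hadd x y _ _ hx hy =>
    obtain ⟨s, hs⟩ := hx
    obtain ⟨t, ht⟩ := hy
    refine ⟨s ∪ t, fun r hr => ?_⟩
    rw [map_add, hs r (Finset.union_subset_left hr), ht r (Finset.union_subset_right hr)]

end

lemma isCompactObject.exists_comp_map_sigmaTrunc {c : C} (hc : isCompactObject C c)
    {D : Type u'} [Category.{v} D] [Preadditive D] (G : D ⥤ C) [G.Additive] {ι : Type v}
    (X : ι → D) [HasCoproduct X] [PreservesColimit (Discrete.functor X) G] (g : c ⟶ G.obj (∐ X)) :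
    ∃ s : Finset ι, ∀ t, s ≤ t → g ≫ G.map (sigmaTrunc X t) = g := by
  have := hc ι
  exact exists_map_sigmaTrunc_apply_eq X (G ⋙ preadditiveCoyoneda.obj (.op c)) g

/-- An object `c` is compact if and only if every morphism from `c` to a coproduct factors through a
finite subcoproduct. -/
lemma isCompactObject_iff [HasCoproducts.{v} C] (c : C) :
    isCompactObject C c ↔ ∀ (ι : Type v) (X : ι → C) (g : c ⟶ ∐ X),
      ∃ s : Finset ι, g ≫ sigmaTrunc X s = g := by
  classical
  refine ⟨fun hc ι X g => ?_, fun h ι => ?_⟩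
  · obtain ⟨s, hs⟩ := hc.exists_comp_map_sigmaTrunc (𝟭 C) X g
    exact ⟨s, hs s le_rfl⟩
  · suffices ∀ X : ι → C, PreservesColimit (Discrete.functor X)
        (preadditiveCoyoneda.obj (.op c)) from preservesColimitsOfShape_of_discrete _
    intro X
    let G := preadditiveCoyoneda.obj (Opposite.op c)
    suffices IsIso (sigmaComparison G X) from PreservesCoproduct.of_iso_comparison G X
    rw [ConcreteCategory.isIso_iff_bijective]
    constructor
    · rw [injective_iff_map_eq_zero]
      intro x hx
      obtain ⟨s, hs⟩ := exists_map_sigmaTrunc_apply_eq (fun i => G.obj (X i)) (𝟭 _) x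
      rw [← hs s le_rfl]
      have hπ (i : ι) : Sigma.π (fun i => G.obj (X i)) i =
          sigmaComparison G X ≫ G.map (Sigma.π X i) := by
        refine Sigma.hom_ext _ _ fun j => ?_
        rw [ι_comp_sigmaComparison_assoc, ← G.map_comp]
        by_cases hij : j = i
        · subst hij
          simp
        · rw [Sigma.ι_π_of_ne _ hij, Sigma.ι_π_of_ne _ hij, G.map_zero]
      have hπx (i : ι) : Sigma.π (fun i => G.obj (X i)) i x = 0 := by
        rw [hπ, ConcreteCategory.comp_apply, hx, map_zero]
      change AddCommGrpCat.homAddEquiv (sigmaTrunc (fun i => G.obj (X i)) s) x = 0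
      rw [sigmaTrunc, map_sum, AddMonoidHom.finsetSum_apply]
      refine Finset.sum_eq_zero fun i _ => ?_
      change Sigma.ι (fun i => G.obj (X i)) i (Sigma.π (fun i => G.obj (X i)) i x) = 0
      rw [hπx, map_zero]
    · intro (g : c ⟶ ∐ X)
      obtain ⟨s, hs⟩ := h ι X g
      refine ⟨∑ i ∈ s, Sigma.ι (fun i => G.obj (X i)) i (g ≫ Sigma.π X i), ?_⟩
      have hg : ∑ i ∈ s, (g ≫ Sigma.π X i) ≫ Sigma.ι X i = g := by
        simpa [sigmaTrunc, Preadditive.comp_sum] using hs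
      rw [map_sum]
      refine Eq.trans (Finset.sum_congr rfl fun i _ => ?_) hg
      let y : G.obj (X i) := g ≫ Sigma.π X i
      exact ConcreteCategory.congr_hom (ι_comp_sigmaComparison G X i) y

lemma isCompactObject_of_isZero [HasCoproducts.{v} C] {c : C} (hc : IsZero c) :
    isCompactObject C c :=
  (isCompactObject_iff c).2 fun _ _ _ => ⟨∅, hc.eq_of_src _ _⟩

end Additive

section Triangulated

open Pretriangulated

variable {T : Type u} [Category.{v} T] [Preadditive T] [HasShift T ℤ]
  [∀ n : ℤ, (shiftFunctor T n).Additive] [HasCoproducts.{v} T]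

lemma isCompactObject.shift {c : T} (hc : isCompactObject T c) (n : ℤ) :
    isCompactObject T (c⟦n⟧) := by
  rw [isCompactObject_iff]
  intro ι X g
  obtain ⟨s, hs⟩ := hc.exists_comp_map_sigmaTrunc (shiftFunctor T (-n)) X
    ((shiftShiftNeg c n).inv ≫ g⟦-n⟧')
  refine ⟨s, (shiftFunctor T (-n)).map_injective ?_⟩
  rw [← cancel_epi (shiftShiftNeg c n).inv, Functor.map_comp]
  simpa only [Category.assoc] using hs s le_rfl

variable [HasZeroObject T] [Pretriangulated T]

lemma isCompactObject.of_distTriang₂ {A : Triangle T} (hA : A ∈ distTriang T)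
    (h₁ : isCompactObject T A.obj₁) (h₃ : isCompactObject T A.obj₃) :
    isCompactObject T A.obj₂ := by
  classical
  rw [isCompactObject_iff]
  intro ι X g
  obtain ⟨s, hs⟩ := h₁.exists_comp_map_sigmaTrunc (𝟭 T) X (A.mor₁ ≫ g)
  dsimp at hs
  obtain ⟨k, hk⟩ := A.yoneda_exact₂ hA (g - g ≫ sigmaTrunc X s) (by
    rw [Preadditive.comp_sub, ← Category.assoc, hs s le_rfl, sub_self])
  obtain ⟨t, ht⟩ := h₃.exists_comp_map_sigmaTrunc (𝟭 T) X k
  dsimp at ht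
  refine ⟨s ∪ t, ?_⟩
  have h₁ : (g - g ≫ sigmaTrunc X s) ≫ sigmaTrunc X (s ∪ t) = g - g ≫ sigmaTrunc X s := by
    rw [hk, Category.assoc, ht _ Finset.subset_union_right]
  rw [Preadditive.sub_comp, Category.assoc,
    sigmaTrunc_comp_of_le X Finset.subset_union_left] at h₁
  exact sub_left_injective h₁

lemma isCompactObject.of_distTriang₁ {A : Triangle T} (hA : A ∈ distTriang T)
    (h₂ : isCompactObject T A.obj₂) (h₃ : isCompactObject T A.obj₃) :
    isCompactObject T A.obj₁ :=
  isCompactObject.of_distTriang₂ (inv_rot_of_distTriang _ hA) (h₃.shift (-1)) h₂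

lemma isCompactObject.of_distTriang₃ {A : Triangle T} (hA : A ∈ distTriang T)
    (h₁ : isCompactObject T A.obj₁) (h₂ : isCompactObject T A.obj₂) :
    isCompactObject T A.obj₃ :=
  isCompactObject.of_distTriang₂ (rot_of_distTriang _ hA) h₂ (h₁.shift 1)

lemma isCompactObject.biprod {c d : T} (hc : isCompactObject T c) (hd : isCompactObject T d) :
    isCompactObject T (c ⊞ d) :=
  isCompactObject.of_distTriang₂ (binaryBiproductTriangle_distinguished c d) hc hd

end Triangulated

/-! ### Compact approximation of coproduct-preserving exact functors -/

section Approximation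

open Pretriangulated

variable {T : Type u} [Category.{v} T]

section

variable [Preadditive T] {C : Type u'} [Category.{v} C] (G : T ⥤ C)

/-- The morphism `g : c ⟶ G X` comes from a morphism `c ⟶ G d` along some `d ⟶ X` with `d`
compact. -/
def FactorsThroughCompact {c : C} {X : T} (g : c ⟶ G.obj X) : Prop :=
  ∃ d, isCompactObject T d ∧ ∃ (a : d ⟶ X) (h : c ⟶ G.obj d), h ≫ G.map a = g

/-- The morphism `a : d ⟶ X` factors through a morphism `d ⟶ e` to a compact object whose image
under `G` annihilates `h : c ⟶ G d`. -/
def KilledByCompact [HasZeroMorphisms C] {c : C} {d X : T} (h : c ⟶ G.obj d) (a : d ⟶ X) : Prop :=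
  ∃ e, isCompactObject T e ∧ ∃ (b : d ⟶ e) (a' : e ⟶ X), b ≫ a' = a ∧ h ≫ G.map b = 0

/-- For every compact `c`, the group `Hom(c, G X)` is the filtered colimit of the groups
`Hom(c, G d)` over the compact objects `d` over `X`: the first field is surjectivity of the
comparison map, the second one is its injectivity. -/
structure IsCompactlyApproximated [Preadditive C] (X : T) : Prop where
  factors : ∀ {c : C}, isCompactObject C c → ∀ g : c ⟶ G.obj X, FactorsThroughCompact G g
  killed : ∀ {c : C} {d : T}, isCompactObject C c → isCompactObject T d →
    ∀ (h : c ⟶ G.obj d) (a : d ⟶ X), h ≫ G.map a = 0 → KilledByCompact G h a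

variable {G}

lemma FactorsThroughCompact.comp_map {c : C} {X Y : T} {g : c ⟶ G.obj X}
    (hg : FactorsThroughCompact G g) (w : X ⟶ Y) : FactorsThroughCompact G (g ≫ G.map w) := by
  obtain ⟨d, hd, a, h, rfl⟩ := hg
  exact ⟨d, hd, a ≫ w, h, by simp⟩

lemma KilledByCompact.comp [HasZeroMorphisms C] {c : C} {d X Y : T} {h : c ⟶ G.obj d} {a : d ⟶ X}
    (ha : KilledByCompact G h a) (w : X ⟶ Y) : KilledByCompact G h (a ≫ w) := by
  obtain ⟨e, he, b, a', rfl, hb⟩ := ha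
  exact ⟨e, he, b, a' ≫ w, by simp, hb⟩

variable [Preadditive C]

lemma FactorsThroughCompact.zero [HasZeroObject T] [HasCoproducts.{v} T] {c : C} {X : T} :
    FactorsThroughCompact G (0 : c ⟶ G.obj X) :=
  have ⟨z, hz⟩ := HasZeroObject.zero (C := T)
  ⟨z, isCompactObject_of_isZero hz, 0, 0, by simp⟩

lemma KilledByCompact.zero [HasZeroObject T]
    [HasCoproducts.{v} T] [G.Additive] {c : C} {d X : T} {h : c ⟶ G.obj d} :
    KilledByCompact G h (0 : d ⟶ X) :=
  have ⟨z, hz⟩ := HasZeroObject.zero (C := T)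
  ⟨z, isCompactObject_of_isZero hz, 0, 0, by simp, by simp⟩

lemma isCompactlyApproximated_of_isCompactObject {X : T} (hX : isCompactObject T X) :
    IsCompactlyApproximated G X where
  factors _ g := ⟨X, hX, 𝟙 X, g, by simp⟩
  killed _ _ h a ha := ⟨X, hX, a, 𝟙 X, by simp, ha⟩

lemma IsCompactlyApproximated.of_iso {X Y : T} (hX : IsCompactlyApproximated G X) (i : X ≅ Y) :
    IsCompactlyApproximated G Y where
  factors hc g := by simpa using (hX.factors hc (g ≫ G.map i.inv)).comp_map i.hom
  killed hc hd h a ha := by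
    simpa using (hX.killed hc hd h (a ≫ i.inv) (by simp [reassoc_of% ha])).comp i.hom

end

variable [Preadditive T] [HasZeroObject T] [HasShift T ℤ]
  [∀ n : ℤ, (shiftFunctor T n).Additive] [Pretriangulated T] [HasCoproducts.{v} T]
  {C : Type u'} [Category.{v} C] [Preadditive C] {G : T ⥤ C}

lemma FactorsThroughCompact.add {c : C} {X : T} {g g' : c ⟶ G.obj X}
    (hg : FactorsThroughCompact G g) (hg' : FactorsThroughCompact G g') :
    FactorsThroughCompact G (g + g') := by
  obtain ⟨d, hd, a, h, rfl⟩ := hg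
  obtain ⟨d', hd', a', h', rfl⟩ := hg'
  refine ⟨d ⊞ d', hd.biprod hd', biprod.desc a a',
    h ≫ G.map biprod.inl + h' ≫ G.map biprod.inr, ?_⟩
  simp [← Functor.map_comp]

lemma KilledByCompact.add [G.Additive] {c : C} {d X : T} {h : c ⟶ G.obj d} {a a' : d ⟶ X}
    (ha : KilledByCompact G h a) (ha' : KilledByCompact G h a') :
    KilledByCompact G h (a + a') := by
  obtain ⟨e, he, b, k, rfl, hb⟩ := ha
  obtain ⟨e', he', b', k', rfl, hb'⟩ := ha'
  refine ⟨e ⊞ e', he.biprod he', biprod.lift b b', biprod.desc k k', by simp, ?_⟩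
  have : biprod.lift b b' = b ≫ biprod.inl + b' ≫ biprod.inr := by
    ext <;> simp
  simp [this, reassoc_of% hb, reassoc_of% hb']

/-- A morphism from a compact object to a coproduct only sees a finite subcoproduct, so both halves
of the approximation property can be checked on the summands. -/
lemma isCompactlyApproximated_sigma [G.Additive] {ι : Type v} (X : ι → T)
    [PreservesColimit (Discrete.functor X) G] (hX : ∀ i, IsCompactlyApproximated G (X i)) :
    IsCompactlyApproximated G (∐ X) where
  factors hc g := by
    classical
    obtain ⟨s, hs⟩ := hc.exists_comp_map_sigmaTrunc G X g
    rw [← hs s le_rfl, sigmaTrunc, G.map_sum, Preadditive.comp_sum]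
    refine Finset.sum_induction _ _ (fun _ _ => .add) .zero fun i _ => ?_
    rw [G.map_comp, ← Category.assoc]
    exact ((hX i).factors hc _).comp_map _
  killed hc hd h a ha := by
    classical
    obtain ⟨s, hs⟩ := hd.exists_comp_map_sigmaTrunc (𝟭 T) X a
    have := hs s le_rfl
    dsimp at this
    rw [← this, sigmaTrunc, Preadditive.comp_sum]
    refine Finset.sum_induction _ _ (fun _ _ => .add) .zero fun i _ => ?_
    rw [← Category.assoc]
    refine ((hX i).killed hc hd h _ ?_).comp _
    rw [G.map_comp, reassoc_of% ha, zero_comp]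

variable [HasZeroObject C] [HasShift C ℤ] [∀ n : ℤ, (shiftFunctor C n).Additive]
  [Pretriangulated C] [G.CommShift ℤ] [G.IsTriangulated]

/-- The part of the five lemma for `Hom(c, G -)` along a triangle which gives surjectivity of the
comparison map for the middle term. -/
lemma factors_of_distTriang {A : Triangle T} (hA : A ∈ distTriang T)
    (h₁ : IsCompactlyApproximated G A.obj₁) (h₃ : IsCompactlyApproximated G A.obj₃)
    (h₁' : IsCompactlyApproximated G (A.obj₁⟦(1 : ℤ)⟧)) {c : C} (hc : isCompactObject C c)
    (g : c ⟶ G.obj A.obj₂) : FactorsThroughCompact G g := by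
  obtain ⟨d, hd, a, h, ha⟩ := h₃.factors hc (g ≫ G.map A.mor₂)
  obtain ⟨e, he, b, a', hba', hb⟩ := h₁'.killed hc hd h (a ≫ A.mor₃) (by
    rw [G.map_comp, reassoc_of% ha, ← G.map_comp, comp_distTriang_mor_zero₂₃ A hA, G.map_zero,
      comp_zero])
  obtain ⟨d', i, w, hB⟩ := distinguished_cocone_triangle₁ b
  obtain ⟨(m : d' ⟶ A.obj₂), (hm : i ≫ a = m ≫ A.mor₂), -⟩ :=
    complete_distinguished_triangle_morphism₁ _ _ hB (rot_of_distTriang _ hA) a a' hba'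
  have hd' : isCompactObject T d' := isCompactObject.of_distTriang₁ hB hd he
  obtain ⟨(h' : c ⟶ G.obj d'), (hh : h = h' ≫ G.map i)⟩ :=
    (G.mapTriangle.obj _).coyoneda_exact₂ (G.map_distinguished _ hB) h hb
  subst hh
  obtain ⟨(k : c ⟶ G.obj A.obj₁), (hk : g - h' ≫ G.map m = k ≫ G.map A.mor₁)⟩ :=
    (G.mapTriangle.obj _).coyoneda_exact₂ (G.map_distinguished _ hA) (g - h' ≫ G.map m) (by
      change (g - h' ≫ G.map m) ≫ G.map A.mor₂ = 0
      rw [Preadditive.sub_comp, ← ha, Category.assoc, Category.assoc, ← G.map_comp, ← G.map_comp,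
        hm, sub_self])
  rw [← sub_add_cancel g (h' ≫ G.map m), hk]
  exact ((h₁.factors hc k).comp_map _).add ⟨d', hd', m, h', rfl⟩

/-- The part of the five lemma for `Hom(c, G -)` along a triangle which gives injectivity of the
comparison map for the middle term. -/
lemma killed_of_distTriang {A : Triangle T} (hA : A ∈ distTriang T)
    (h₁ : IsCompactlyApproximated G A.obj₁) (h₃ : IsCompactlyApproximated G A.obj₃)
    (h₃' : IsCompactlyApproximated G (A.obj₃⟦(-1 : ℤ)⟧)) {c : C} {d : T}
    (hc : isCompactObject C c) (hd : isCompactObject T d) (h : c ⟶ G.obj d) (a : d ⟶ A.obj₂)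
    (ha : h ≫ G.map a = 0) : KilledByCompact G h a := by
  obtain ⟨e, he, b, a', hba', hb⟩ := h₃.killed hc hd h (a ≫ A.mor₂) (by
    rw [G.map_comp, reassoc_of% ha, zero_comp])
  obtain ⟨d', i, w, hB⟩ := distinguished_cocone_triangle₁ b
  obtain ⟨(m : d' ⟶ A.obj₁), (hm : i ≫ a = m ≫ A.mor₁), -⟩ :=
    complete_distinguished_triangle_morphism₁ _ _ hB hA a a' hba'
  have hd' : isCompactObject T d' := isCompactObject.of_distTriang₁ hB hd he
  obtain ⟨(h' : c ⟶ G.obj d'), (hh : h = h' ≫ G.map i)⟩ :=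
    (G.mapTriangle.obj _).coyoneda_exact₂ (G.map_distinguished _ hB) h hb
  subst hh
  have hA' := inv_rot_of_distTriang _ hA
  obtain ⟨w', hw'⟩ : ∃ w' : A.obj₃⟦(-1 : ℤ)⟧ ⟶ A.obj₁, w' = A.invRotate.mor₁ := ⟨_, rfl⟩
  have hz' : w' ≫ A.mor₁ = 0 := by
    rw [hw']
    exact comp_distTriang_mor_zero₁₂ _ hA'
  obtain ⟨(k : c ⟶ G.obj (A.obj₃⟦(-1 : ℤ)⟧)), (hk : h' ≫ G.map m = k ≫ G.map _)⟩ :=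
    (G.mapTriangle.obj _).coyoneda_exact₂ (G.map_distinguished _ hA') (h' ≫ G.map m) (by
      change (h' ≫ G.map m) ≫ G.map A.mor₁ = 0
      rw [Category.assoc, ← G.map_comp, ← hm, G.map_comp, ← Category.assoc, ha])
  obtain ⟨e', he', z, k', rfl⟩ := h₃'.factors hc k
  have hk' : h' ≫ G.map m = (k' ≫ G.map z) ≫ G.map w' := by
    rw [hw']
    exact hk
  obtain ⟨l, hl, β, γ, hβγ, hβ⟩ := h₁.killed hc (hd'.biprod he')
    (h' ≫ G.map biprod.inl + k' ≫ G.map biprod.inr) (biprod.desc m (-(z ≫ w'))) (by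
      rw [Preadditive.add_comp, Category.assoc, Category.assoc, ← G.map_comp, ← G.map_comp,
        biprod.inl_desc, biprod.inr_desc, hk']
      simp)
  -- The object `P` is the homotopy pushout of `d` and `l` under `d' ⊞ e'`.
  obtain ⟨P, p, r, hP⟩ := distinguished_cocone_triangle (biprod.lift (biprod.desc i 0) (-β))
  have hPc : isCompactObject T P :=
    isCompactObject.of_distTriang₃ hP (hd'.biprod he') (hd.biprod hl)
  obtain ⟨(t : P ⟶ A.obj₂), (ht : biprod.desc a (γ ≫ A.mor₁) = p ≫ t)⟩ :=
    Triangle.yoneda_exact₂ _ hP (biprod.desc a (γ ≫ A.mor₁)) (by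
    change biprod.lift (biprod.desc i 0) (-β) ≫ biprod.desc a (γ ≫ A.mor₁) = 0
    rw [biprod.lift_desc, Preadditive.neg_comp, ← Category.assoc β, hβγ]
    ext <;> simp [hm, hz'])
  have hp : biprod.lift (biprod.desc i 0) (-β) ≫ p = 0 := comp_distTriang_mor_zero₁₂ _ hP
  refine ⟨P, hPc, biprod.inl ≫ p, t, by rw [Category.assoc, ← ht, biprod.inl_desc], ?_⟩
  have hp' : biprod.desc i 0 ≫ biprod.inl ≫ p = β ≫ biprod.inr ≫ p := by
    have : biprod.lift (biprod.desc i 0) (-β) =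
        biprod.desc i 0 ≫ biprod.inl - β ≫ biprod.inr := by
      ext <;> simp
    rw [this, Preadditive.sub_comp, sub_eq_zero] at hp
    simpa using hp
  have hi : h' ≫ G.map i =
      (h' ≫ G.map biprod.inl + k' ≫ G.map biprod.inr) ≫ G.map (biprod.desc i 0) := by
    simp [← Functor.map_comp]
  rw [hi, Category.assoc, ← G.map_comp, hp', G.map_comp, reassoc_of% hβ, zero_comp]

/-- If the compact objects generate `T`, then every object is compactly approximated with respect
to a coproduct-preserving exact functor. -/
lemma isCompactlyApproximated [∀ ι : Type v, PreservesColimitsOfShape (Discrete ι) G]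
    (hT : ∀ S : ObjectProperty T, IsLocalizing S → isCompactObject T ≤ S → ∀ X : T, S X) (X : T) :
    IsCompactlyApproximated G X := by
  let Q : ObjectProperty T := fun X => ∀ n : ℤ, IsCompactlyApproximated G (X⟦n⟧)
  have hQiso : Q.IsClosedUnderIsomorphisms :=
    ⟨fun i h n => (h n).of_iso ((shiftFunctor T n).mapIso i)⟩
  have hQc : isCompactObject T ≤ Q := fun X hX n =>
    isCompactlyApproximated_of_isCompactObject (hX.shift n)
  have hQshift : Q.IsStableUnderShift ℤ :=
    ⟨fun a => ⟨fun X hX n => (hX (a + n)).of_iso ((shiftFunctorAdd T a n).app X)⟩⟩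
  have hQzero : Q.ContainsZero := by
    have ⟨z, hz⟩ := HasZeroObject.zero (C := T)
    exact ⟨z, hz, hQc _ (isCompactObject_of_isZero hz)⟩
  have hQtri : Q.IsTriangulatedClosed₂ := by
    refine .mk' fun A hA h₁ h₃ n => ?_
    have hA' := Triangle.shift_distinguished _ hA n
    have h₁' : IsCompactlyApproximated G ((A.obj₁⟦n⟧)⟦(1 : ℤ)⟧) :=
      (h₁ (n + 1)).of_iso ((shiftFunctorAdd T n 1).app _)
    have h₃' : IsCompactlyApproximated G ((A.obj₃⟦n⟧)⟦(-1 : ℤ)⟧) :=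
      (h₃ (n + (-1))).of_iso ((shiftFunctorAdd T n (-1)).app _)
    exact ⟨factors_of_distTriang hA' (h₁ n) (h₃ n) h₁', killed_of_distTriang hA' (h₁ n) (h₃ n) h₃'⟩
  have hQ : IsLocalizing Q :=
    { isTriangulated := { }
      isClosedUnderIsomorphisms := hQiso
      closed_coproducts := fun ι => isClosedUnderColimitsOfShape_discrete fun Y hY n =>
        (isCompactlyApproximated_sigma (fun i => (Y i)⟦n⟧) (fun i => hY i n)).of_iso
          (PreservesCoproduct.iso (shiftFunctor T n) Y).symm }
  exact (hT Q hQ hQc X 0).of_iso ((shiftFunctorZero T ℤ).app X)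

end Approximation

section Generation

open Pretriangulated

variable {T : Type u} [Category.{v} T] [Preadditive T] [HasZeroObject T] [HasShift T ℤ]
  [∀ n : ℤ, (shiftFunctor T n).Additive] [Pretriangulated T] [HasCoproducts.{v} T]

/-- If the compact objects generate `T`, then they detect zero objects. -/
lemma isZero_of_forall_compact
    (hT : ∀ S : ObjectProperty T, IsLocalizing S → isCompactObject T ≤ S → ∀ X : T, S X) {W : T}
    (hW : ∀ c, isCompactObject T c → ∀ f : c ⟶ W, f = 0) : IsZero W := by
  let P : ObjectProperty T := fun V => ∃ n : ℤ, Nonempty (V ≅ W⟦n⟧)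
  have : P.IsStableUnderShift ℤ := ⟨fun a => ⟨fun V ⟨n, ⟨i⟩⟩ =>
    ⟨n + a, ⟨(shiftFunctor T a).mapIso i ≪≫ ((shiftFunctorAdd T n a).app W).symm⟩⟩⟩⟩
  have hL : IsLocalizing P.leftOrthogonal :=
    { isTriangulated := inferInstance
      isClosedUnderIsomorphisms := inferInstance
      closed_coproducts := fun ι => isClosedUnderColimitsOfShape_discrete fun Y hY V f hV =>
        Sigma.hom_ext _ _ fun i => by simpa using hY i (Sigma.ι Y i ≫ f) hV }
  rw [IsZero.iff_id_eq_zero]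
  refine hT _ hL ?_ W _ ⟨0, ⟨((shiftFunctorZero T ℤ).app W).symm⟩⟩
  rintro c hc V f ⟨n, ⟨i⟩⟩
  have h := hW _ (hc.shift (-n)) ((f ≫ i.hom)⟦-n⟧' ≫ (shiftShiftNeg W n).hom)
  rw [← cancel_mono i.hom, zero_comp]
  apply (shiftFunctor T (-n)).map_injective
  rw [← cancel_mono (shiftShiftNeg W n).hom, h, Functor.map_zero, zero_comp]

end Generation

/-! ### Exactness of the tensor product -/

section Tensor

open Pretriangulated

lemma isZero_tensor_comm {T : Type u} [Category.{v} T] [MonoidalCategory T] [BraidedCategory T]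
    {X Y : T} (h : IsZero (X ⊗ Y)) : IsZero (Y ⊗ X) :=
  h.of_iso (β_ Y X)

variable {T : Type u} [Category.{v} T] [Preadditive T] [HasZeroObject T] [HasShift T ℤ]
  [∀ n : ℤ, (shiftFunctor T n).Additive] [Pretriangulated T] [IsTriangulated T]
  [MonoidalCategory T] [SymmetricCategory T] [BigTTCategory T]

instance BigTTCategory.instHasColimitsOfShapeDiscrete (ι : Type v) :
    HasColimitsOfShape (Discrete ι) T :=
  BigTTCategory.hasCoproducts ι

noncomputable instance tensorLeftCommShift (X : T) : (tensorLeft X).CommShift ℤ :=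
  (BigTTCategory.tensor_exact X).choose

instance tensorLeft_isTriangulated (X : T) : (tensorLeft X).IsTriangulated :=
  (BigTTCategory.tensor_exact X).choose_spec

noncomputable instance tensorRightCommShift (X : T) : (tensorRight X).CommShift ℤ :=
  Functor.CommShift.ofIso (BraidedCategory.tensorLeftIsoTensorRight X) ℤ

instance tensorRight_isTriangulated (X : T) : (tensorRight X).IsTriangulated :=
  have := Functor.CommShift.ofIso_compatibility (BraidedCategory.tensorLeftIsoTensorRight X) ℤ
  Functor.isTriangulated_of_iso (BraidedCategory.tensorLeftIsoTensorRight X)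

instance tensorLeft_preservesCoproducts (X : T) (ι : Type v) :
    PreservesColimitsOfShape (Discrete ι) (tensorLeft X) :=
  BigTTCategory.tensor_coproducts X ι

instance tensorRight_preservesCoproducts (X : T) (ι : Type v) :
    PreservesColimitsOfShape (Discrete ι) (tensorRight X) :=
  preservesColimitsOfShape_of_natIso (BraidedCategory.tensorLeftIsoTensorRight X)

instance BigTTCategory.monoidalPreadditive : MonoidalPreadditive T where
  whiskerLeft_zero {X Y Z} := (tensorLeft X).map_zero Y Z
  zero_whiskerRight {X Y Z} := (tensorRight X).map_zero Y Z
  whiskerLeft_add {X _ _} _ _ := (tensorLeft X).map_add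
  add_whiskerRight {X _ _} _ _ := (tensorRight X).map_add

lemma tensorLeft_distinguished (X : T) {A B C : T} {a : A ⟶ B} {b : B ⟶ C} {c : C ⟶ A⟦(1 : ℤ)⟧}
    (h : Triangle.mk a b c ∈ distTriang T) :
    ∃ c', Triangle.mk (X ◁ a) (X ◁ b) c' ∈ distTriang T :=
  ⟨_, (tensorLeft X).map_distinguished _ h⟩

lemma tensorRight_distinguished (X : T) {A B C : T} {a : A ⟶ B} {b : B ⟶ C}
    {c : C ⟶ A⟦(1 : ℤ)⟧} (h : Triangle.mk a b c ∈ distTriang T) :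
    ∃ c', Triangle.mk (a ▷ X) (b ▷ X) c' ∈ distTriang T :=
  ⟨_, (tensorRight X).map_distinguished _ h⟩

lemma isZero_tensor_left {Y : T} (hY : IsZero Y) (X : T) : IsZero (X ⊗ Y) :=
  (tensorLeft X).map_isZero hY

lemma isZero_tensor_right {X : T} (hX : IsZero X) (Y : T) : IsZero (X ⊗ Y) :=
  (tensorRight Y).map_isZero hX

lemma isZero_tensor_tensor {X Y : T} (h : IsZero (X ⊗ Y)) (W : T) : IsZero (X ⊗ W ⊗ Y) :=
  (isZero_tensor_left h W).of_iso
    ((α_ X W Y).symm ≪≫ (whiskerRightIso (β_ X W) Y) ≪≫ α_ W X Y)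

end Tensor

/-! ### Acyclic objects and idempotent triangles -/

section Acyclics

open Pretriangulated

lemma isZero_map_sigma {C : Type u} [Category.{v} C] {D : Type u'} [Category.{v} D]
    [Preadditive D] {ι : Type*} (H : C ⥤ D) (X : ι → C)
    [HasCoproduct X] [PreservesColimit (Discrete.functor X) H]
    (hX : ∀ i, IsZero (H.obj (X i))) : IsZero (H.obj (∐ X)) := by
  rw [IsZero.iff_id_eq_zero]
  refine (isColimitOfHasCoproductOfPreservesColimit H X).hom_ext ?_
  rintro ⟨i⟩
  exact (hX i).eq_of_src _ _

section

variable {T : Type u} [Category.{v} T] [MonoidalCategory T]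

/-- The objects annihilated by tensoring with `R`. -/
def acyclics (R : T) : ObjectProperty T :=
  fun X => IsZero (R ⊗ X)

end

section

variable (T : Type u) [Category.{v} T] [Preadditive T] [HasZeroObject T] [HasShift T ℤ]
  [∀ n : ℤ, (shiftFunctor T n).Additive] [Pretriangulated T] [MonoidalCategory T]

/-- An idempotent triangle: a distinguished triangle `E ⟶ 𝟙 ⟶ R ⟶ E⟦1⟧` with `R ⊗ E = 0`. Such
triangles are the same thing as smashing ideals, the ideal being the one of `R`-acyclic objects. -/
structure IdempotentTriangle where
  /-- the left idempotent -/
  E : T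
  /-- the right idempotent -/
  R : T
  /-- the counit of the left idempotent -/
  e : E ⟶ 𝟙_ T
  /-- the unit of the right idempotent -/
  f : 𝟙_ T ⟶ R
  /-- the connecting morphism -/
  d : R ⟶ E⟦(1 : ℤ)⟧
  dist : Triangle.mk e f d ∈ distTriang T
  isZero : IsZero (R ⊗ E)

end

variable {T : Type u} [Category.{v} T] [Preadditive T] [HasZeroObject T] [HasShift T ℤ]
  [∀ n : ℤ, (shiftFunctor T n).Additive] [Pretriangulated T]
  [MonoidalCategory T] [SymmetricCategory T]

lemma IsLocalizingIdeal.tensor_mem_right {S : ObjectProperty T} (hS : IsLocalizingIdeal S) {X : T}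
    (hX : S X) (Y : T) : S (X ⊗ Y) :=
  have := hS.isClosedUnderIsomorphisms
  S.prop_of_iso (β_ Y X) (hS.tensor_mem Y X hX)

variable [IsTriangulated T] [BigTTCategory T]

instance (R : T) : (acyclics R).IsClosedUnderIsomorphisms :=
  ⟨fun i h => h.of_iso ((tensorLeft R).mapIso i.symm)⟩

lemma isLocalizingIdeal_acyclics (R : T) : IsLocalizingIdeal (acyclics R) where
  isTriangulated :=
    have : (acyclics R).IsStableUnderShift ℤ := ⟨fun a => ⟨fun X hX =>
      ((shiftFunctor T a).map_isZero hX).of_iso (((tensorLeft R).commShiftIso a).app X)⟩⟩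
    have ⟨z, hz⟩ := HasZeroObject.zero (C := T)
    have : (acyclics R).ContainsZero := ⟨z, hz, isZero_tensor_left hz R⟩
    have : (acyclics R).IsTriangulatedClosed₂ := .mk' fun A hA h₁ h₃ =>
      Triangle.isZero₂_of_isZero₁₃ _ ((tensorLeft R).map_distinguished A hA) h₁ h₃
    { }
  isClosedUnderIsomorphisms := inferInstance
  closed_coproducts _ := isClosedUnderColimitsOfShape_discrete fun Y hY =>
    isZero_map_sigma (tensorLeft R) Y hY
  tensor_mem X _ hY := isZero_tensor_tensor hY X

namespace IdempotentTriangle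

variable (τ : IdempotentTriangle T)

lemma acyclics_iff_isIso (X : T) : acyclics τ.R X ↔ IsIso (τ.e ▷ X) := by
  obtain ⟨_, h⟩ := tensorRight_distinguished X τ.dist
  exact Triangle.isZero₃_iff_isIso₁ _ h

/-- An acyclic object `X` is isomorphic to `E ⊗ X`. -/
lemma acyclics_le_iff {S : ObjectProperty T} (hS : IsLocalizingIdeal S) :
    acyclics τ.R ≤ S ↔ S τ.E := by
  refine ⟨fun h => h _ τ.isZero, fun h X hX => ?_⟩
  have := hS.isClosedUnderIsomorphisms
  have := (τ.acyclics_iff_isIso X).1 hX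
  exact S.prop_of_iso (asIso (τ.e ▷ X) ≪≫ λ_ X) (hS.tensor_mem_right h X)

/-- A morphism from an acyclic object `Y` to `R ⊗ X` factors through `E ⊗ R ⊗ X = 0`, because
`Y` is isomorphic to `E ⊗ Y`. -/
lemma rightOrthogonal (X : T) : (acyclics τ.R).rightOrthogonal (τ.R ⊗ X) := by
  intro Y g hY
  have := (τ.acyclics_iff_isIso Y).1 hY
  have hz : IsZero (τ.E ⊗ τ.R ⊗ X) :=
    (isZero_tensor_right (isZero_tensor_comm τ.isZero) X).of_iso (α_ τ.E τ.R X).symm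
  rw [← cancel_epi (λ_ Y).hom, ← cancel_epi (τ.e ▷ Y), ← leftUnitor_naturality,
    ← whisker_exchange_assoc, hz.eq_of_tgt (τ.E ◁ g) 0]
  simp

lemma isSmashingIdeal : IsSmashingIdeal (acyclics τ.R) where
  toIsLocalizingIdeal := isLocalizingIdeal_acyclics τ.R
  exists_triangle := ⟨_, _, _, _, _, τ.dist, τ.isZero, τ.rightOrthogonal⟩

end IdempotentTriangle

lemma IsSmashingIdeal.exists_eq_acyclics {S : ObjectProperty T} (hS : IsSmashingIdeal S) :
    ∃ τ : IdempotentTriangle T, S = acyclics τ.R := by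
  obtain ⟨E, R, e, f, d, h, hE, hR⟩ := hS.exists_triangle
  have hz {X : T} (hX : S X) : IsZero (R ⊗ X) := by
    rw [IsZero.iff_id_eq_zero]
    exact hR X _ (hS.tensor_mem R X hX)
  let τ : IdempotentTriangle T := ⟨E, R, e, f, d, h, hz hE⟩
  exact ⟨τ, le_antisymm (fun X hX => hz hX) ((τ.acyclics_le_iff hS.toIsLocalizingIdeal).2 hE)⟩

end Acyclics

/-! ### Smashing ideals form a small set -/

section Small

open Pretriangulated

variable {T : Type u} [Category.{v} T]

/-- The morphism `φ` factors through an object of `S`. -/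
def ObjectFactors (S : ObjectProperty T) {c d : T} (φ : c ⟶ d) : Prop :=
  ∃ Z, S Z ∧ ∃ (a : c ⟶ Z) (b : Z ⟶ d), a ≫ b = φ

lemma ObjectFactors.comp_left {S : ObjectProperty T} {c d e : T} {φ : c ⟶ d}
    (h : ObjectFactors S φ) (ψ : e ⟶ c) : ObjectFactors S (ψ ≫ φ) := by
  obtain ⟨Z, hZ, a, b, rfl⟩ := h
  exact ⟨Z, hZ, ψ ≫ a, b, by simp⟩

lemma ObjectFactors.comp_right {S : ObjectProperty T} {c d e : T} {φ : c ⟶ d}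
    (h : ObjectFactors S φ) (ψ : d ⟶ e) : ObjectFactors S (φ ≫ ψ) := by
  obtain ⟨Z, hZ, a, b, rfl⟩ := h
  exact ⟨Z, hZ, a, b ≫ ψ, by simp⟩

variable [Preadditive T] [HasZeroObject T] [HasShift T ℤ]
  [∀ n : ℤ, (shiftFunctor T n).Additive] [Pretriangulated T] [IsTriangulated T]
  [MonoidalCategory T] [SymmetricCategory T] [BigTTCategory T]

/-- A morphism from a compact object to an object of a smashing ideal factors through a morphism
of compact objects which itself factors through an object of the ideal: the map `c ⟶ R ⊗ c`
becomes zero in `R ⊗ X = 0`, hence already in `R ⊗ e` for some compact `e` between `c` and `X`. -/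
lemma IdempotentTriangle.exists_factorization (τ : IdempotentTriangle T) {c X : T}
    (hc : isCompactObject T c) (hX : acyclics τ.R X) (g : c ⟶ X) :
    ∃ e, isCompactObject T e ∧ ∃ (b : c ⟶ e) (a : e ⟶ X),
      b ≫ a = g ∧ ObjectFactors (acyclics τ.R) b := by
  have H := isCompactlyApproximated (G := tensorLeft τ.R) BigTTCategory.generated X
  obtain ⟨e, he, b, a, hba, hb⟩ := H.killed hc hc ((λ_ c).inv ≫ τ.f ▷ c) g (hX.eq_of_tgt _ _)
  have hb' : (λ_ c).inv ≫ τ.f ▷ c ≫ τ.R ◁ b = 0 := by simpa using hb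
  obtain ⟨_, h⟩ := tensorRight_distinguished e τ.dist
  obtain ⟨(k : c ⟶ τ.E ⊗ e), (hk : b ≫ (λ_ e).inv = k ≫ τ.e ▷ e)⟩ :=
    Triangle.coyoneda_exact₂ _ h (b ≫ (λ_ e).inv) (by
      change (b ≫ (λ_ e).inv) ≫ τ.f ▷ e = 0
      rw [← whisker_exchange] at hb'
      simpa using hb')
  refine ⟨e, he, b, a, hba, τ.E ⊗ e,
    (isLocalizingIdeal_acyclics τ.R).tensor_mem_right τ.isZero e, k, τ.e ▷ e ≫ (λ_ e).hom, ?_⟩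
  rw [← Category.assoc, ← hk]
  simp

/-- A smashing ideal is determined by the morphisms of compact objects which factor through it. -/
lemma IsSmashingIdeal.le_of_forall_objectFactors {S S' : ObjectProperty T} (hS : IsSmashingIdeal S)
    (hS' : IsSmashingIdeal S')
    (h : ∀ ⦃c d : T⦄, isCompactObject T c → isCompactObject T d → ∀ φ : c ⟶ d,
      ObjectFactors S φ → ObjectFactors S' φ) : S ≤ S' := by
  obtain ⟨τ, rfl⟩ := hS.exists_eq_acyclics
  obtain ⟨σ, rfl⟩ := hS'.exists_eq_acyclics
  intro X hX
  refine isZero_of_forall_compact BigTTCategory.generated fun c hc g => ?_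
  obtain ⟨e, he, b, a, rfl, hb⟩ :=
    τ.exists_factorization hc ((isLocalizingIdeal_acyclics τ.R).tensor_mem σ.R X hX) g
  obtain ⟨Z, hZ, p, q, rfl⟩ := h hc he b hb
  rw [Category.assoc, σ.rightOrthogonal X (q ≫ a) hZ, comp_zero]

variable (T) in
instance small_smashingIdeal : Small.{v} (SmashingIdeal T) := by
  have := BigTTCategory.essentiallySmall_compact (T := T)
  obtain ⟨P, _, hP, hP'⟩ := ObjectProperty.EssentiallySmall.exists_small_le (isCompactObject T)
  let Φ (S : SmashingIdeal T) : Set (Σ p : Subtype P × Subtype P, p.1.1 ⟶ p.2.1) :=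
    {x | ObjectFactors S.1 x.2}
  have hΦ {S S' : SmashingIdeal T} (h : Φ S ≤ Φ S') : S.1 ≤ S'.1 := by
    refine S.2.le_of_forall_objectFactors S'.2 fun c d hc hd φ hφ => ?_
    obtain ⟨c', hc', ⟨i⟩⟩ := hP' c hc
    obtain ⟨d', hd', ⟨j⟩⟩ := hP' d hd
    have : ObjectFactors S'.1 (i.inv ≫ φ ≫ j.hom) :=
      h (a := ⟨(⟨c', hc'⟩, ⟨d', hd'⟩), i.inv ≫ φ ≫ j.hom⟩)
        ((hφ.comp_right j.hom).comp_left i.inv)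
    simpa using (this.comp_right j.inv).comp_left i.hom
  exact small_of_injective (f := Φ) fun S S' h =>
    Subtype.ext (le_antisymm (hΦ h.le) (hΦ h.ge))

end Small

/-! ### Sequential homotopy colimits -/

section Hocolim

open Pretriangulated

lemma hasColimitsOfShape_discrete_nat {C : Type u} [Category.{v} C] [HasCoproducts.{v} C] :
    HasColimitsOfShape (Discrete ℕ) C :=
  hasColimitsOfShape_of_equivalence (Discrete.equivalence Equiv.ulift.{v})

lemma preservesColimitsOfShape_discrete_nat {C : Type u} [Category.{v} C] {D : Type u'}
    [Category.{v} D] (H : C ⥤ D) [∀ ι : Type v, PreservesColimitsOfShape (Discrete ι) H] :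
    PreservesColimitsOfShape (Discrete ℕ) H :=
  preservesColimitsOfShape_of_equiv (Discrete.equivalence Equiv.ulift.{v}) H

variable {T : Type u} [Category.{v} T] [Preadditive T]
  {P : ℕ → T} (s : ∀ n, P n ⟶ P (n + 1)) [HasCoproduct P]

/-- The endomorphism `1 - shift` of `∐ P` attached to a sequence of morphisms. -/
noncomputable def oneSubShift : ∐ P ⟶ ∐ P :=
  Sigma.desc fun n => Sigma.ι P n - s n ≫ Sigma.ι P (n + 1)

lemma ι_oneSubShift (n : ℕ) :
    Sigma.ι P n ≫ oneSubShift s = Sigma.ι P n - s n ≫ Sigma.ι P (n + 1) := by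
  simp [oneSubShift]

variable [HasZeroObject T] [HasShift T ℤ] [∀ n : ℤ, (shiftFunctor T n).Additive]
  [Pretriangulated T]

/-- The homotopy colimit of a sequence: a cone of `1 - shift`. -/
noncomputable def hocolim : T :=
  (distinguished_cocone_triangle (oneSubShift s)).choose

/-- The projection of the coproduct of a sequence to its homotopy colimit. -/
noncomputable def hocolimπ : ∐ P ⟶ hocolim s :=
  (distinguished_cocone_triangle (oneSubShift s)).choose_spec.choose

lemma hocolim_distinguished : ∃ d, Triangle.mk (oneSubShift s) (hocolimπ s) d ∈ distTriang T :=
  (distinguished_cocone_triangle (oneSubShift s)).choose_spec.choose_spec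

/-- The canonical morphism from the `n`-th term of a sequence to its homotopy colimit. -/
noncomputable def hocolimι (n : ℕ) : P n ⟶ hocolim s :=
  Sigma.ι P n ≫ hocolimπ s

lemma hocolimι_succ (n : ℕ) : s n ≫ hocolimι s (n + 1) = hocolimι s n := by
  obtain ⟨d, h⟩ := hocolim_distinguished s
  have h₀ : oneSubShift s ≫ hocolimπ s = 0 := comp_distTriang_mor_zero₁₂ _ h
  have := Sigma.ι P n ≫= h₀
  rw [← Category.assoc, ι_oneSubShift, comp_zero, Preadditive.sub_comp, sub_eq_zero,
    Category.assoc] at this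
  exact this.symm

variable {D : Type u'} [Category.{v} D] [Preadditive D] [HasZeroObject D] [HasShift D ℤ]
  [∀ n : ℤ, (shiftFunctor D n).Additive] [Pretriangulated D]
  (Φ : T ⥤ D) [Φ.CommShift ℤ] [Φ.IsTriangulated] [PreservesColimit (Discrete.functor P) Φ]

lemma isZero_map_hocolim (hs : ∀ n, Φ.map (s n) = 0) : IsZero (Φ.obj (hocolim s)) := by
  obtain ⟨d, h⟩ := hocolim_distinguished s
  refine Triangle.isZero₃_of_isIso₁ _ (Φ.map_distinguished _ h) ?_
  have : Φ.map (oneSubShift s) = 𝟙 _ := by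
    refine (isColimitOfHasCoproductOfPreservesColimit Φ P).hom_ext ?_
    rintro ⟨n⟩
    change Φ.map (Sigma.ι P n) ≫ Φ.map (oneSubShift s) = Φ.map (Sigma.ι P n) ≫ 𝟙 _
    rw [← Φ.map_comp, ι_oneSubShift, Φ.map_sub, Φ.map_comp, hs, zero_comp, sub_zero,
      Category.comp_id]
  change IsIso (Φ.map (oneSubShift s))
  rw [this]
  infer_instance

/-- A sequence of isomorphisms has its first term as homotopy colimit. The morphism `1 - shift` is
then a split monomorphism, with retraction `-(shift⁻¹ + shift⁻² + ⋯)`, a sum which is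
finite on each term of the sequence. -/
lemma isIso_map_hocolimι_zero (hs : ∀ n, IsIso (Φ.map (s n))) : IsIso (Φ.map (hocolimι s 0)) := by
  obtain ⟨d, h⟩ := hocolim_distinguished s
  have hΦ := Φ.map_distinguished _ h
  let hc := isColimitOfHasCoproductOfPreservesColimit Φ P
  let j (n : ℕ) : Φ.obj (P n) ⟶ Φ.obj (∐ P) := Φ.map (Sigma.ι P n)
  have hj {W : D} {a b : Φ.obj (∐ P) ⟶ W} (hab : ∀ n, j n ≫ a = j n ≫ b) : a = b :=
    hc.hom_ext fun ⟨n⟩ => hab n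
  have hdesc {W : D} (k : ∀ n, Φ.obj (P n) ⟶ W) : ∃ a : Φ.obj (∐ P) ⟶ W, ∀ n, j n ≫ a = k n :=
    ⟨hc.desc (Cofan.mk W k), fun n => hc.fac (Cofan.mk W k) ⟨n⟩⟩
  have hshift (n : ℕ) : j n ≫ Φ.map (oneSubShift s) = j n - Φ.map (s n) ≫ j (n + 1) := by
    rw [← Φ.map_comp, ι_oneSubShift, Φ.map_sub, Φ.map_comp]
  let ρ (n : ℕ) : Φ.obj (P n) ⟶ Φ.obj (∐ P) :=
    Nat.rec (motive := fun n => Φ.obj (P n) ⟶ Φ.obj (∐ P)) 0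
      (fun n r => inv (Φ.map (s n)) ≫ (r - j n)) n
  obtain ⟨r, hr⟩ := hdesc ρ
  have hr' : Φ.map (oneSubShift s) ≫ r = 𝟙 _ := hj fun n => by
    have hρ : ρ (n + 1) = inv (Φ.map (s n)) ≫ (ρ n - j n) := rfl
    rw [← Category.assoc, hshift, Preadditive.sub_comp, Category.assoc, hr, hr, hρ,
      IsIso.hom_inv_id_assoc, sub_sub_cancel, Category.comp_id]
  let t (n : ℕ) : Φ.obj (P n) ⟶ Φ.obj (P 0) :=
    Nat.rec (motive := fun n => Φ.obj (P n) ⟶ Φ.obj (P 0)) (𝟙 _)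
      (fun n r => inv (Φ.map (s n)) ≫ r) n
  have ht (n : ℕ) : t (n + 1) = inv (Φ.map (s n)) ≫ t n := rfl
  obtain ⟨c, hc'⟩ := hdesc t
  have hz : Φ.map (oneSubShift s) ≫ c = 0 := hj fun n => by
    rw [← Category.assoc, hshift, Preadditive.sub_comp, Category.assoc, hc', hc', ht,
      IsIso.hom_inv_id_assoc, sub_self, comp_zero]
  obtain ⟨(c' : Φ.obj (hocolim s) ⟶ Φ.obj (P 0)), (hcc' : c = Φ.map (hocolimπ s) ≫ c')⟩ :=
    Triangle.yoneda_exact₂ _ hΦ c hz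
  have : Epi (Φ.map (hocolimπ s)) := by
    refine Triangle.epi₂ _ hΦ ?_
    refine (Triangle.mor₃_eq_zero_iff_mono₁ _ hΦ).2 ?_
    exact (SplitMono.mk r hr').mono
  have hι (n : ℕ) : t n ≫ Φ.map (hocolimι s 0) = Φ.map (hocolimι s n) := by
    induction n with
    | zero => exact Category.id_comp _
    | succ n ih =>
      rw [ht, Category.assoc, ih, IsIso.inv_comp_eq, ← Φ.map_comp, hocolimι_succ]
  refine ⟨c', ?_, ?_⟩
  · rw [hocolimι, Φ.map_comp, Category.assoc, ← hcc']
    exact hc' 0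
  · rw [← cancel_epi (Φ.map (hocolimπ s)), ← Category.assoc, ← hcc']
    refine hj fun n => ?_
    rw [← Category.assoc, hc', hι, hocolimι, Φ.map_comp, Category.comp_id]

end Hocolim

/-! ### Images of smashing ideals -/

section Image

open Pretriangulated Functor.Monoidal

variable {T : Type u} [Category.{v} T] [Preadditive T] [HasZeroObject T] [HasShift T ℤ]
  [∀ n : ℤ, (shiftFunctor T n).Additive] [Pretriangulated T] [MonoidalCategory T]
  {U : Type u'} [Category.{v} U] [Preadditive U] [HasZeroObject U] [HasShift U ℤ]
  [∀ n : ℤ, (shiftFunctor U n).Additive] [Pretriangulated U] [MonoidalCategory U]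

namespace IdempotentTriangle

variable (τ : IdempotentTriangle T) (F : T ⥤ U) [F.Monoidal] [F.CommShift ℤ] [F.IsTriangulated]

/-- The image of an idempotent triangle under an exact monoidal functor. -/
noncomputable def map : IdempotentTriangle U where
  E := F.obj τ.E
  R := F.obj τ.R
  e := F.map τ.e ≫ (εIso F).inv
  f := (εIso F).hom ≫ F.map τ.f
  d := F.map τ.d ≫ (F.commShiftIso (1 : ℤ)).hom.app τ.E
  dist := by
    refine isomorphic_distinguished _ (F.map_distinguished _ τ.dist) _
      (Triangle.isoMk _ _ (Iso.refl (F.obj τ.E)) (εIso F) (Iso.refl (F.obj τ.R)) ?_ ?_ ?_)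
    · change (F.map τ.e ≫ (εIso F).inv) ≫ (εIso F).hom = 𝟙 _ ≫ F.map τ.e
      rw [Category.assoc, Iso.inv_hom_id, Category.comp_id, Category.id_comp]
    · exact Category.comp_id _
    · change (F.map τ.d ≫ (F.commShiftIso (1 : ℤ)).hom.app τ.E) ≫ (𝟙 (F.obj τ.E))⟦(1 : ℤ)⟧' =
        𝟙 _ ≫ F.map τ.d ≫ (F.commShiftIso (1 : ℤ)).hom.app τ.E
      rw [CategoryTheory.Functor.map_id]
      exact (Category.comp_id _).trans (Category.id_comp _).symm
  isZero := (F.map_isZero τ.isZero).of_iso (μIso F _ _)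

lemma locIdeal_map_acyclics [IsTriangulated U] [SymmetricCategory U] [BigTTCategory U] :
    locIdeal ((acyclics τ.R).map F) = acyclics (F.obj τ.R) := by
  apply le_antisymm
  · intro X hX
    refine hX _ (isLocalizingIdeal_acyclics _) ?_
    rintro _ ⟨Y, hY, ⟨i⟩⟩
    exact (acyclics (F.obj τ.R)).prop_of_iso i ((F.map_isZero hY).of_iso (μIso F _ _))
  · intro X hX S hS h
    exact ((τ.map F).acyclics_le_iff hS).2
      (h _ (ObjectProperty.prop_map_obj _ F τ.isZero)) X hX

end IdempotentTriangle

end Image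

/-! ### Intersections of smashing ideals -/

section Intersection

open Pretriangulated

variable {T : Type u} [Category.{v} T] [Preadditive T] [HasZeroObject T] [HasShift T ℤ]
  [∀ n : ℤ, (shiftFunctor T n).Additive] [Pretriangulated T] [MonoidalCategory T]

lemma IsLocalizingIdeal.inf {S S' : ObjectProperty T} (hS : IsLocalizingIdeal S)
    (hS' : IsLocalizingIdeal S') : IsLocalizingIdeal (S ⊓ S') where
  isTriangulated :=
    have := hS.isTriangulated
    have := hS'.isTriangulated
    have := hS.isClosedUnderIsomorphisms
    have := hS'.isClosedUnderIsomorphisms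
    inferInstance
  isClosedUnderIsomorphisms :=
    have := hS.isClosedUnderIsomorphisms
    have := hS'.isClosedUnderIsomorphisms
    inferInstance
  closed_coproducts ι := ⟨fun _ ⟨h⟩ =>
    have := hS.closed_coproducts ι
    have := hS'.closed_coproducts ι
    ⟨ObjectProperty.prop_of_isColimit (P := S) h.isColimit fun j => (h.prop_diag_obj j).1,
      ObjectProperty.prop_of_isColimit (P := S') h.isColimit fun j => (h.prop_diag_obj j).2⟩⟩
  tensor_mem X Y h := ⟨hS.tensor_mem X Y h.1, hS'.tensor_mem X Y h.2⟩

variable [IsTriangulated T] [SymmetricCategory T] [BigTTCategory T]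

lemma IdempotentTriangle.tensor_mem_inf (σ τ : IdempotentTriangle T) :
    (acyclics σ.R ⊓ acyclics τ.R) (σ.E ⊗ τ.E) :=
  ⟨(isLocalizingIdeal_acyclics σ.R).tensor_mem_right σ.isZero τ.E,
    (isLocalizingIdeal_acyclics τ.R).tensor_mem σ.E τ.E τ.isZero⟩

/-- The left idempotent of the intersection is the tensor product of the left idempotents. -/
lemma IsSmashingIdeal.inf {S S' : ObjectProperty T} (hS : IsSmashingIdeal S)
    (hS' : IsSmashingIdeal S') : IsSmashingIdeal (S ⊓ S') := by
  obtain ⟨σ, rfl⟩ := hS.exists_eq_acyclics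
  obtain ⟨τ, rfl⟩ := hS'.exists_eq_acyclics
  obtain ⟨R, f, d, h⟩ := distinguished_cocone_triangle (σ.E ◁ τ.e ≫ (ρ_ σ.E).hom ≫ σ.e)
  have hR {X : T} (hX : (acyclics σ.R ⊓ acyclics τ.R) X) : IsZero (R ⊗ X) := by
    obtain ⟨_, h'⟩ := tensorRight_distinguished X h
    have := (σ.acyclics_iff_isIso X).1 hX.1
    have := (τ.acyclics_iff_isIso X).1 hX.2
    refine Triangle.isZero₃_of_isIso₁ _ h' ?_
    change IsIso ((σ.E ◁ τ.e ≫ (ρ_ σ.E).hom ≫ σ.e) ▷ X)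
    rw [comp_whiskerRight, comp_whiskerRight, whisker_assoc]
    infer_instance
  let ω : IdempotentTriangle T :=
    { E := σ.E ⊗ τ.E, R := R, e := _, f := f, d := d, dist := h, isZero := hR (σ.tensor_mem_inf τ) }
  have : acyclics σ.R ⊓ acyclics τ.R = acyclics ω.R := le_antisymm (fun X hX => hR hX)
    ((ω.acyclics_le_iff ((isLocalizingIdeal_acyclics σ.R).inf (isLocalizingIdeal_acyclics τ.R))).2
      (σ.tensor_mem_inf τ))
  rw [this]
  exact ω.isSmashingIdeal

end Intersection

/-! ### Joins of small families of smashing ideals -/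

section Join

open Pretriangulated Functor.Monoidal

variable {T : Type u} [Category.{v} T] [MonoidalCategory T]

/-- The tensor powers of `C`, with `C ^ (n + 1) = C ⊗ C ^ n`. -/
def tensorPow (C : T) : ℕ → T
  | 0 => 𝟙_ T
  | n + 1 => C ⊗ tensorPow C n

/-- The morphism `C ^ n ⟶ C ^ (n + 1)` which inserts a unit `𝟙 ⟶ C` in the first factor. -/
def tensorPowUnit {C : T} (c : 𝟙_ T ⟶ C) (n : ℕ) : tensorPow C n ⟶ tensorPow C (n + 1) :=
  (λ_ (tensorPow C n)).inv ≫ c ▷ tensorPow C n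

variable [Preadditive T] [HasZeroObject T] [HasShift T ℤ]
  [∀ n : ℤ, (shiftFunctor T n).Additive] [Pretriangulated T] [IsTriangulated T]
  [SymmetricCategory T] [BigTTCategory T]

namespace IdempotentTriangle

variable {ι : Type v} (τ : ι → IdempotentTriangle T)

/-- The sum `∐ E i ⟶ 𝟙` of the counits of a family of idempotent triangles. -/
noncomputable def sumCounit : (∐ fun i => (τ i).E) ⟶ 𝟙_ T :=
  Sigma.desc fun i => (τ i).e

/-- The cone of `∐ E i ⟶ 𝟙`. -/
noncomputable def coverCone : T :=
  (distinguished_cocone_triangle (sumCounit τ)).choose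

/-- The morphism from the unit to the cone of `∐ E i ⟶ 𝟙`. -/
noncomputable def coverUnit : 𝟙_ T ⟶ coverCone τ :=
  (distinguished_cocone_triangle (sumCounit τ)).choose_spec.choose

lemma cover_distinguished :
    ∃ d, Triangle.mk (sumCounit τ) (coverUnit τ) d ∈ distTriang T :=
  (distinguished_cocone_triangle (sumCounit τ)).choose_spec.choose_spec

instance : HasColimitsOfShape (Discrete ℕ) T :=
  hasColimitsOfShape_discrete_nat

/-- The right idempotent of the join of a family of smashing ideals: the homotopy colimit of the
tensor powers of the cone of `∐ E i ⟶ 𝟙`. -/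
noncomputable def joinR : T :=
  hocolim (tensorPowUnit (coverUnit τ))

/-- The unit of the right idempotent of the join. -/
noncomputable def joinUnit : 𝟙_ T ⟶ joinR τ :=
  hocolimι (tensorPowUnit (coverUnit τ)) 0

/-- Since `E i ⊗ E i ≅ E i` and `E i ⟶ 𝟙 ⟶ coverCone τ` vanishes, tensoring with `E i` annihilates
the transition morphisms of the sequence with homotopy colimit `joinR τ`. -/
lemma isZero_tensor_joinR (i : ι) : IsZero ((τ i).E ⊗ joinR τ) := by
  have := preservesColimitsOfShape_discrete_nat (tensorLeft (τ i).E)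
  refine isZero_map_hocolim _ (tensorLeft (τ i).E) fun n => ?_
  have h : (τ i).E ◁ coverUnit τ = 0 := by
    obtain ⟨_, hd⟩ := cover_distinguished τ
    have h₀ : sumCounit τ ≫ coverUnit τ = 0 := comp_distTriang_mor_zero₁₂ _ hd
    have h₁ : (τ i).e ≫ coverUnit τ = 0 := by
      have := Sigma.ι (fun i => (τ i).E) i ≫= h₀
      simpa [sumCounit] using this
    obtain ⟨_, hd'⟩ := tensorLeft_distinguished (τ i).E (τ i).dist
    have : IsIso ((τ i).E ◁ (τ i).e) :=
      (Triangle.isZero₃_iff_isIso₁ _ hd').1 (isZero_tensor_comm (τ i).isZero)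
    rw [← cancel_epi ((τ i).E ◁ (τ i).e), ← MonoidalCategory.whiskerLeft_comp, h₁, comp_zero,
      MonoidalPreadditive.whiskerLeft_zero]
  change (τ i).E ◁ ((λ_ _).inv ≫ coverUnit τ ▷ _) = 0
  rw [MonoidalCategory.whiskerLeft_comp, whisker_assoc_symm, h]
  simp

/-- An exact coproduct-preserving functor which annihilates all `E i ⊗ X` inverts the transition
morphisms of the sequence with homotopy colimit `joinR τ`. -/
lemma isIso_map_joinUnit {D : Type u'} [Category.{v} D] [Preadditive D] [HasZeroObject D]
    [HasShift D ℤ] [∀ n : ℤ, (shiftFunctor D n).Additive] [Pretriangulated D] (Φ : T ⥤ D)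
    [Φ.CommShift ℤ] [Φ.IsTriangulated] [∀ κ : Type v, PreservesColimitsOfShape (Discrete κ) Φ]
    (h : ∀ i X, IsZero (Φ.obj ((τ i).E ⊗ X))) : IsIso (Φ.map (joinUnit τ)) := by
  have := preservesColimitsOfShape_discrete_nat Φ
  refine isIso_map_hocolimι_zero _ Φ fun n => ?_
  let X := tensorPow (coverCone τ) n
  obtain ⟨_, hd⟩ := cover_distinguished τ
  have : IsIso (Φ.map (coverUnit τ ▷ X)) :=
    (Triangle.isZero₁_iff_isIso₂ _ ((tensorRight X ⋙ Φ).map_distinguished _ hd)).1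
      (isZero_map_sigma (tensorRight X ⋙ Φ) (fun i => (τ i).E) fun i => h i X)
  change IsIso (Φ.map ((λ_ X).inv ≫ coverUnit τ ▷ X))
  rw [Φ.map_comp]
  infer_instance

/-- An object which is annihilated by the images of the `E i` and of the right idempotent of the
join is zero. -/
lemma isZero_of_isZero_map_joinR {U : Type u'} [Category.{v} U] [Preadditive U] [HasZeroObject U]
    [HasShift U ℤ] [∀ n : ℤ, (shiftFunctor U n).Additive] [Pretriangulated U] [IsTriangulated U]
    [MonoidalCategory U] [SymmetricCategory U] [BigTTCategory U] (F : T ⥤ U) [F.Monoidal]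
    [F.CommShift ℤ] [F.IsTriangulated] [∀ κ : Type v, PreservesColimitsOfShape (Discrete κ) F]
    {W : U} (h : ∀ i, IsZero (F.obj (τ i).E ⊗ W)) (hR : IsZero (F.obj (joinR τ) ⊗ W)) :
    IsZero W := by
  have := isIso_map_joinUnit τ (F ⋙ tensorRight W) fun i X =>
    (isZero_tensor_tensor (h i) (F.obj X)).of_iso
      (whiskerRightIso (μIso F _ _).symm W ≪≫ α_ (F.obj (τ i).E) (F.obj X) W)
  have hz : IsZero (F.obj (𝟙_ T) ⊗ W) := hR.of_iso (asIso ((F ⋙ tensorRight W).map (joinUnit τ)))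
  exact hz.of_iso ((λ_ W).symm ≪≫ whiskerRightIso (εIso F) W)

/-- The idempotent triangle of the join of a family of smashing ideals. -/
noncomputable def join : IdempotentTriangle T where
  E := (distinguished_cocone_triangle₁ (joinUnit τ)).choose
  R := joinR τ
  e := (distinguished_cocone_triangle₁ (joinUnit τ)).choose_spec.choose
  f := joinUnit τ
  d := (distinguished_cocone_triangle₁ (joinUnit τ)).choose_spec.choose_spec.choose
  dist := (distinguished_cocone_triangle₁ (joinUnit τ)).choose_spec.choose_spec.choose_spec
  isZero := by
    obtain ⟨_, h⟩ := tensorRight_distinguished (joinR τ)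
      (distinguished_cocone_triangle₁ (joinUnit τ)).choose_spec.choose_spec.choose_spec
    refine isZero_tensor_comm (Triangle.isZero₁_of_isIso₂ _ h ?_)
    exact isIso_map_joinUnit τ (tensorRight (joinR τ)) fun i X =>
      (isZero_tensor_tensor (isZero_tensor_joinR τ i) X).of_iso (α_ _ _ _)

lemma acyclics_map_join_le_iff {U : Type u'} [Category.{v} U] [Preadditive U] [HasZeroObject U]
    [HasShift U ℤ] [∀ n : ℤ, (shiftFunctor U n).Additive] [Pretriangulated U] [IsTriangulated U]
    [MonoidalCategory U] [SymmetricCategory U] [BigTTCategory U] (F : T ⥤ U) [F.Monoidal]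
    [F.CommShift ℤ] [F.IsTriangulated] [∀ κ : Type v, PreservesColimitsOfShape (Discrete κ) F]
    (R : U) :
    acyclics (F.obj (join τ).R) ≤ acyclics R ↔ ∀ i, acyclics (F.obj (τ i).R) ≤ acyclics R := by
  have hloc := isLocalizingIdeal_acyclics R
  have key (i : ι) : acyclics (F.obj (τ i).R) ≤ acyclics R ↔ acyclics R (F.obj (τ i).E) :=
    ((τ i).map F).acyclics_le_iff hloc
  refine ⟨fun h i => (key i).2 (h _ ?_), fun h X hX => ?_⟩
  · exact (F.map_isZero (isZero_tensor_comm (isZero_tensor_joinR τ i))).of_iso (μIso F _ _)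
  · refine isZero_of_isZero_map_joinR τ F (fun i => ?_) (isZero_tensor_tensor hX R)
    exact (isZero_tensor_right (isZero_tensor_comm ((key i).1 (h i))) X).of_iso (α_ _ _ _).symm

end IdempotentTriangle

end Join

/-! ### The frame of smashing ideals -/

section Frame

open Pretriangulated Functor.Monoidal

variable {T : Type u} [Category.{v} T] [Preadditive T] [HasZeroObject T] [HasShift T ℤ]
  [∀ n : ℤ, (shiftFunctor T n).Additive] [Pretriangulated T] [IsTriangulated T]
  [MonoidalCategory T] [SymmetricCategory T] [BigTTCategory T]
  {U : Type u'} [Category.{v} U] [Preadditive U] [HasZeroObject U] [HasShift U ℤ]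
  [∀ n : ℤ, (shiftFunctor U n).Additive] [Pretriangulated U] [IsTriangulated U]
  [MonoidalCategory U] [SymmetricCategory U] [BigTTCategory U]

/-- The smashing ideal of acyclic objects of an idempotent triangle. -/
def IdempotentTriangle.ideal (τ : IdempotentTriangle T) : SmashingIdeal T :=
  ⟨acyclics τ.R, τ.isSmashingIdeal⟩

namespace SmashingIdeal

lemma exists_eq_ideal (S : SmashingIdeal T) : ∃ τ : IdempotentTriangle T, S = τ.ideal := by
  obtain ⟨τ, hτ⟩ := S.2.exists_eq_acyclics
  exact ⟨τ, Subtype.ext hτ⟩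

/-- Every set of smashing ideals is the range of a family indexed by a type in the universe of the
morphisms, for which coproducts exist. -/
lemma exists_eq_range (s : Set (SmashingIdeal T)) :
    ∃ (ι : Type v) (τ : ι → IdempotentTriangle T), s = Set.range fun i => (τ i).ideal := by
  choose τ hτ using exists_eq_ideal (T := T)
  refine ⟨Shrink.{v} s, fun i => τ ((equivShrink s).symm i).1, Set.ext fun S => ⟨fun hS => ?_, ?_⟩⟩
  · exact ⟨equivShrink s ⟨S, hS⟩, by simp [← hτ]⟩
  · rintro ⟨i, rfl⟩
    simp [← hτ]

lemma isLUB_join {ι : Type v} (τ : ι → IdempotentTriangle T) :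
    IsLUB (Set.range fun i => (τ i).ideal) (IdempotentTriangle.join τ).ideal := by
  refine isLUB_iff_le_iff.2 fun S => ?_
  obtain ⟨σ, rfl⟩ := exists_eq_ideal S
  rw [mem_upperBounds, Set.forall_mem_range]
  exact IdempotentTriangle.acyclics_map_join_le_iff τ (𝟭 T) σ.R

lemma isGLB_inf (S S' : SmashingIdeal T) :
    IsGLB {S, S'} (⟨S.1 ⊓ S'.1, S.2.inf S'.2⟩ : SmashingIdeal T) :=
  ⟨by simpa [lowerBounds] using ⟨inf_le_left (a := S.1), inf_le_right (a := S.1)⟩,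
    fun S₀ h => show S₀.1 ≤ S.1 ⊓ S'.1 from
      le_inf (h (Set.mem_insert S _)) (h (Set.mem_insert_of_mem S rfl))⟩

lemma isGLB_pair_iff (S S' M : SmashingIdeal T) : IsGLB {S, S'} M ↔ M.1 = S.1 ⊓ S'.1 := by
  refine ⟨fun h => congrArg Subtype.val (h.unique (isGLB_inf S S')), fun h => ?_⟩
  obtain rfl : M = ⟨S.1 ⊓ S'.1, S.2.inf S'.2⟩ := Subtype.ext h
  exact isGLB_inf S S'

variable (T) in
lemma isFrame : IsFrame (SmashingIdeal T) where
  exists_isLUB s := by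
    obtain ⟨ι, τ, rfl⟩ := exists_eq_range s
    exact ⟨_, isLUB_join τ⟩
  isLUB_inf S s B M hB hM := by
    obtain ⟨ι, τ, rfl⟩ := exists_eq_range s
    obtain rfl := hB.unique (isLUB_join τ)
    rw [isGLB_pair_iff] at hM
    refine ⟨?_, fun S' hS' => ?_⟩
    · rintro D ⟨_, ⟨i, rfl⟩, hD⟩
      rw [isGLB_pair_iff] at hD
      change D.1 ≤ M.1
      rw [hD, hM]
      exact inf_le_inf_left S.1 ((isLUB_join τ).1 ⟨i, rfl⟩)
    · obtain ⟨σ, rfl⟩ := exists_eq_ideal S'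
      intro X hX
      rw [hM] at hX
      -- For `X` in both `S` and the join, `E i ⊗ X` lies in `S ⊓ S i`, so `σ.R ⊗ X` is annihilated
      -- by all `E i` and by the right idempotent of the join.
      refine IdempotentTriangle.isZero_of_isZero_map_joinR τ (𝟭 T) (fun i => ?_)
        (isZero_tensor_tensor hX.2 σ.R)
      have h : acyclics σ.R ((τ i).E ⊗ X) :=
        hS' ⟨_, ⟨i, rfl⟩, isGLB_inf S (τ i).ideal⟩ _
          ⟨S.2.tensor_mem _ X hX.1,
            (isLocalizingIdeal_acyclics (τ i).R).tensor_mem_right (τ i).isZero X⟩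
      exact h.of_iso ((α_ _ _ _).symm ≪≫ whiskerRightIso (β_ _ _) X ≪≫ α_ _ _ _)

variable (F : T ⥤ U) [F.Monoidal] [F.CommShift ℤ] [F.IsTriangulated]

/-- The smashing ideal generated by the image of a smashing ideal. -/
def map (S : SmashingIdeal T) : SmashingIdeal U :=
  ⟨locIdeal (S.1.map F), by
    obtain ⟨τ, rfl⟩ := exists_eq_ideal S
    change IsSmashingIdeal (locIdeal ((acyclics τ.R).map F))
    rw [τ.locIdeal_map_acyclics F]
    exact (τ.map F).isSmashingIdeal⟩

lemma map_ideal (τ : IdempotentTriangle T) : map F τ.ideal = (τ.map F).ideal :=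
  Subtype.ext (τ.locIdeal_map_acyclics F)

lemma map_mono : Monotone (map F) := fun _ _ h _ hX S hS hS' =>
  hX S hS fun _ ⟨Y, hY, i⟩ => hS' _ ⟨Y, h Y hY, i⟩

lemma isGLB_map {S S' M : SmashingIdeal T} (hM : IsGLB {S, S'} M) :
    IsGLB {map F S, map F S'} (map F M) := by
  rw [isGLB_pair_iff]
  apply le_antisymm
  · exact le_inf (map_mono F (hM.1 (by simp))) (map_mono F (hM.1 (by simp)))
  rw [isGLB_pair_iff] at hM
  obtain ⟨σ, rfl⟩ := exists_eq_ideal S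
  obtain ⟨τ, rfl⟩ := exists_eq_ideal S'
  rw [map_ideal, map_ideal]
  rintro X ⟨hX, hX'⟩ L hL hML
  have := hL.isClosedUnderIsomorphisms
  -- Such an object `X` is isomorphic to `F (σ.E ⊗ τ.E) ⊗ X`.
  have h : L (F.obj σ.E ⊗ F.obj τ.E) :=
    hML _ ⟨_, hM ▸ σ.tensor_mem_inf τ, ⟨(μIso F _ _).symm⟩⟩
  have hσ := ((σ.map F).acyclics_iff_isIso X).1 hX
  have hτ := ((τ.map F).acyclics_iff_isIso X).1 hX'
  let i : F.obj σ.E ⊗ X ≅ X := @asIso _ _ _ _ ((σ.map F).e ▷ X) hσ ≪≫ λ_ X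
  let j : F.obj τ.E ⊗ X ≅ X := @asIso _ _ _ _ ((τ.map F).e ▷ X) hτ ≪≫ λ_ X
  exact L.prop_of_iso (α_ (F.obj σ.E) (F.obj τ.E) X ≪≫ whiskerLeftIso (F.obj σ.E) j ≪≫ i)
    (hL.tensor_mem_right h X)

lemma isTop_iff (S : SmashingIdeal T) : IsTop S ↔ S.1 (𝟙_ T) := by
  refine ⟨fun h => ?_, fun h S' X _ => ?_⟩
  · have ⟨z, hz⟩ := HasZeroObject.zero (C := T)
    let τ : IdempotentTriangle T :=
      { E := 𝟙_ T, R := z, e := 𝟙 _, f := 0, d := 0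
        dist := isomorphic_distinguished _ (contractible_distinguished (𝟙_ T)) _
          (Triangle.isoMk _ _ (Iso.refl _) (Iso.refl _) (hz.iso (isZero_zero T))
            ((Category.comp_id _).trans (Category.id_comp _).symm)
            ((isZero_zero T).eq_of_tgt _ _) (hz.eq_of_src _ _))
        isZero := isZero_tensor_right hz _ }
    exact h τ.ideal _ τ.isZero
  · have := S.2.isClosedUnderIsomorphisms
    exact S.1.prop_of_iso (ρ_ X) (S.2.tensor_mem X _ h)

lemma isTop_map {S : SmashingIdeal T} (hS : IsTop S) : IsTop (map F S) := by
  rw [isTop_iff] at hS ⊢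
  exact fun _ _ h => h _ ⟨_, hS, ⟨(εIso F).symm⟩⟩

lemma isLUB_map [∀ κ : Type v, PreservesColimitsOfShape (Discrete κ) F]
    {s : Set (SmashingIdeal T)} {B : SmashingIdeal T} (hB : IsLUB s B) :
    IsLUB (map F '' s) (map F B) := by
  obtain ⟨ι, τ, rfl⟩ := exists_eq_range s
  obtain rfl := hB.unique (isLUB_join τ)
  refine isLUB_iff_le_iff.2 fun S => ?_
  obtain ⟨σ, rfl⟩ := exists_eq_ideal S
  rw [mem_upperBounds, Set.forall_mem_image, Set.forall_mem_range]
  simp only [map_ideal]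
  exact IdempotentTriangle.acyclics_map_join_le_iff τ F σ.R

end SmashingIdeal

end Frame

/-- A map between frames given by their orders which preserves greatest elements, binary infima and
arbitrary suprema, as a `FrameHom`. -/
@[reducible]
noncomputable def IsFrame.frameHom {α : Type u} {β : Type u'} [PartialOrder α] [PartialOrder β]
    (hα : IsFrame α) (hβ : IsFrame β) (f : α → β) (htop : ∀ a, IsTop a → IsTop (f a))
    (hinf : ∀ a b m, IsGLB {a, b} m → IsGLB {f a, f b} (f m))
    (hsup : ∀ s b, IsLUB s b → IsLUB (f '' s) (f b)) :
    letI := hα.toFrame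
    letI := hβ.toFrame
    FrameHom α β :=
  letI := hα.toFrame
  letI := hβ.toFrame
  { toFun := f
    map_inf' := fun _ _ => (hinf _ _ _ isGLB_pair).unique isGLB_pair
    map_top' := le_antisymm le_top (htop _ isTop_top _)
    map_sSup' := fun s => (hsup s _ (isLUB_sSup s)).unique (isLUB_sSup _) }

theorem mainTheorem10
    (T : Type u) [Category.{v} T] [Preadditive T] [HasZeroObject T] [HasShift T ℤ]
    [∀ n : ℤ, (shiftFunctor T n).Additive] [Pretriangulated T] [IsTriangulated T]
    [MonoidalCategory T] [SymmetricCategory T] [BigTTCategory T]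
    (U : Type u') [Category.{v} U] [Preadditive U] [HasZeroObject U] [HasShift U ℤ]
    [∀ n : ℤ, (shiftFunctor U n).Additive] [Pretriangulated U] [IsTriangulated U]
    [MonoidalCategory U] [SymmetricCategory U] [BigTTCategory U]
    (F : T ⥤ U) [F.Monoidal] [F.CommShift ℤ] [F.IsTriangulated]
    (hF : ∀ ι : Type v, PreservesColimitsOfShape (Discrete ι) F) :
    ∃ (hT : IsFrame (SmashingIdeal T)) (hU : IsFrame (SmashingIdeal U)),
      letI := hT.toFrame
      letI := hU.toFrame
      ∃ f : FrameHom (SmashingIdeal T) (SmashingIdeal U),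
        (∀ S : SmashingIdeal T, (f S).1 = locIdeal (S.1.map F)) ∧
        ∃ g : C(Locale.PT (SmashingIdeal U), Locale.PT (SmashingIdeal T)),
          ∀ P : Locale.PT (SmashingIdeal U), g P = FrameHom.comp P f := by
  have hT := SmashingIdeal.isFrame T
  have hU := SmashingIdeal.isFrame U
  refine ⟨hT, hU, ?_⟩
  let := hT.toFrame
  let := hU.toFrame
  let f : FrameHom (SmashingIdeal T) (SmashingIdeal U) :=
    hT.frameHom hU (SmashingIdeal.map F) (fun _ => SmashingIdeal.isTop_map F)
      (fun _ _ _ => SmashingIdeal.isGLB_map F) (fun _ _ => SmashingIdeal.isLUB_map F)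
  refine ⟨f, fun S => rfl, ⟨fun P => FrameHom.comp P f, continuous_def.2 ?_⟩, fun P => rfl⟩
  rintro _ ⟨S, rfl⟩
  exact ⟨f S, rfl⟩
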